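/- Let $(\mathcal X,\mathsf d)$ be a separable metric space, let $\mu$ be a Borel probability measure on $\mathcal X\times\{0,1\}$ with first marginal $\rho$, let $w_i:=\mu(\mathcal X\times\{i\})$ and let $\rho_i:=\mu(\,\cdot\times\{i\})/w_i$ for $i\in\{0,1\}$ (a term with factor $w_i=0$ is read as $0$). Let $\varepsilon>0$, and let $B_r(x)$ denote the open ball. Let $\nu$ be a finite Borel measure on $\mathcal X$ such that 1. $\rho\ll\nu$; 2. $\{x\in\mathcal X:\operatorname{dist}(x,\operatorname{supp}\rho)<\varepsilon\}\subseteq\operatorname{supp}\nu$; 3. $\limsup_{r\downarrow0}\nu(B_{2r}(x))/\nu(B_r(x))<\infty$ for $\nu$-a.e. $x\in\mathcal X$. For Borel measurable, $\nu$-essentially bounded $v:\mathcal X\to\mathbb R$ put $$\widetilde{\mathrm{TV}}_\varepsilon(v;\mu):=\frac{w_0}{\varepsilon}\int_{\mathcal X}\Big(\sup_{B_\varepsilon(x)}v-v(x)\Big)\,d\rho_0(x)+\frac{w_1}{\varepsilon}\int_{\mathcal X}\Big(v(x)-\inf_{B_\varepsilon(x)}v\Big)\,d\rho_1(x)\in[0,\infty],$$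 and for $u\in L^\infty(\mathcal X;\nu)$ put $$\mathrm{TV}^\nu_\varepsilon(u;\mu):=\inf\big\{\widetilde{\mathrm{TV}}_\varepsilon(v;\mu): v:\mathcal X\to\mathbb R\text{ Borel and }\nu\text{-essentially bounded},\ v=u\ \nu\text{-a.e.}\big\}.$$ Then $\mathrm{TV}^\nu_\varepsilon(\cdot;\mu)$ is a finite, positively homogeneous and convex functional on $L^\infty(\mathcal X;\nu)$, and it is weak-* lower semicontinuous in the following sense: if $u_k\rightharpoonup^\ast u$ in $L^\infty(\mathcal X;\nu)$, that is, $\int u_k\varphi\,d\nu\to\int u\varphi\,d\nu$ for all $\varphi\in L^1(\mathcal X;\nu)$, then $$\mathrm{TV}^\nu_\varepsilon(u;\mu)\le\liminf_{k\to\infty}\mathrm{TV}^\nu_\varepsilon(u_k;\mu).$$ -/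

import Mathlib

open MeasureTheory Filter Topology Set
open scoped NNReal ENNReal

namespace AdvTV

noncomputable section

variable {X : Type*} [MetricSpace X] [MeasurableSpace X]

/-- The class probability `w i = μ (X × {i})` of the label `i ∈ {0, 1}`. -/
def classProb (μ : Measure (X × Fin 2)) (i : Fin 2) : ℝ≥0∞ :=
  μ (univ ×ˢ {i})

/-- The conditional distribution `ρ i` of the data given the label `i`:
`ρ i (A) = μ (A × {i}) / w i`. If `w i = 0` this is the zero measure; it only enters
below multiplied by `w i`. -/
def condDistrib (μ : Measure (X × Fin 2)) (i : Fin 2) : Measure X :=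
  (classProb μ i)⁻¹ • (μ.restrict (univ ×ˢ {i})).map Prod.fst

/-- `sup_{B_ε(x)} v - v x`, where `B_ε(x)` is the open ball. The supremum is taken in the extended
reals and may be `+∞`; for `0 < ε` the difference lies in `[0, ∞]`, as `x ∈ B_ε(x)`. -/
def supGap (ε : ℝ) (v : X → ℝ) (x : X) : ℝ≥0∞ :=
  ((⨆ y ∈ Metric.ball x ε, (v y : EReal)) - (v x : EReal)).toENNReal

/-- `v x - inf_{B_ε(x)} v`, with the infimum taken in the extended reals. -/
def infGap (ε : ℝ) (v : X → ℝ) (x : X) : ℝ≥0∞ :=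
  ((v x : EReal) - ⨅ y ∈ Metric.ball x ε, (v y : EReal)).toENNReal

/-- The nonlocal pre-total variation of a function `v : X → ℝ`,
`w₀ / ε * ∫ (sup_{B_ε(x)} v - v x) dρ₀ + w₁ / ε * ∫ (v x - inf_{B_ε(x)} v) dρ₁`. -/
def preTV (ε : ℝ) (μ : Measure (X × Fin 2)) (v : X → ℝ) : ℝ≥0∞ :=
  classProb μ 0 / ENNReal.ofReal ε * ∫⁻ x, supGap ε v x ∂(condDistrib μ 0) +
    classProb μ 1 / ENNReal.ofReal ε * ∫⁻ x, infGap ε v x ∂(condDistrib μ 1)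

/-- The nonlocal total variation on `L^∞(X; ν)`: the infimum of the pre-total variation over all
Borel measurable, `ν`-essentially bounded `v : X → ℝ` with `v = u` `ν`-almost everywhere. -/
def TV (ε : ℝ) (μ : Measure (X × Fin 2)) (ν : Measure X) (u : Lp ℝ ∞ ν) : ℝ≥0∞ :=
  ⨅ v ∈ {v : X → ℝ | Measurable v ∧ MemLp v ∞ ν ∧ v =ᵐ[ν] u}, preTV ε μ v

/-- The standing assumption on the reference measure `ν` (in addition to its finiteness). -/
structure IsReference (ε : ℝ) (μ : Measure (X × Fin 2)) (ν : Measure X) : Prop where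
  /-- The first marginal `ρ` of `μ` is absolutely continuous with respect to `ν`. -/
  fst_absolutelyContinuous : μ.fst ≪ ν
  /-- `{x | dist (x, supp ρ) < ε} ⊆ supp ν`. -/
  thickening_subset : Metric.thickening ε μ.fst.support ⊆ ν.support
  /-- `ν` is locally doubling. -/
  locally_doubling : ∀ᵐ x ∂ν,
    limsup (fun r : ℝ => ν (Metric.ball x (2 * r)) / ν (Metric.ball x r)) (𝓝[>] 0) < ∞

/-- Weak-* convergence `u k ⇀* u` in `L^∞(X; ν) = L¹(X; ν)*`. -/
def WeakStarTendsto (ν : Measure X) (u : ℕ → Lp ℝ ∞ ν) (u₀ : Lp ℝ ∞ ν) : Prop :=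
  ∀ φ : Lp ℝ 1 ν,
    Tendsto (fun k => ∫ x, u k x * φ x ∂ν) atTop (𝓝 (∫ x, u₀ x * φ x ∂ν))

end

end AdvTV

/-!
Write `m i` (`labelMeasure μ i`) for the part of the first marginal of `μ` that carries the label
`i`, so that `m i = w i • ρ i`. The total variation has a closed form in which the infimum over
representatives is gone (`IsReference.TV_eq`):

`ε * TV u = ∫ (ess sup_{B_ε(x)} u - u x) d(m 0) + ∫ (u x - ess inf_{B_ε(x)} u) d(m 1)`,

with essential suprema and infima taken with respect to `ν`. The second term is the first one for
`-u`, so everything reduces to the one-sided functional `gapIntegral`.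

The inequality `≥` holds because a pointwise supremum over a ball dominates the essential supremum
(`ballEssSup_le_iSup`). For `≤`, a single representative of `u` has to be optimal for both terms.
Let `U x` and `L x` be the limits as `r ↓ 0` of the essential supremum and infimum of `u` over
`B_r(x)`. Then `L ≤ u ≤ U` almost everywhere, and `L ≤ U` on the support of `ν`; hence
`v = min U (max u L)` (`optRep`) is a representative of `u` with `L ≤ v ≤ U` on the support. If
`B_ε(x)` is contained in the support, every `y ∈ B_ε(x)` has small balls inside `B_ε(x)`, so
`ess inf_{B_ε(x)} u ≤ v y ≤ ess sup_{B_ε(x)} u`. That `u ≤ U` almost everywhere follows from a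
countable cover by small balls (`ae_le_ballEssSup`); no differentiation of measures enters, so the
doubling property of `ν` plays no role.

Finiteness, homogeneity and convexity are inherited from the essential supremum. For lower
semicontinuity, a weak-* convergent sequence is bounded by the Banach–Steinhaus theorem
(`WeakStarTendsto.exists_isEssBddBy`), the essential supremum over a fixed ball is weak-* lower
semicontinuous (`eventually_lt_ballSup`), Fatou's lemma carries this over to the integral, and the
linear terms `∫ u d(m i)` converge because `m i` has a density in `L¹(ν)`
(`gapIntegral_le_liminf`).
-/

namespace AdvTV

section

variable {X : Type*} [MeasurableSpace X]

/-! ### Essentially bounded functions -/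

/-- `f` is measurable and bounded by `M` in absolute value, `ν`-almost everywhere. -/
structure IsEssBddBy (ν : Measure X) (M : ℝ) (f : X → ℝ) : Prop where
  measurable : Measurable f
  ae_le : ∀ᵐ y ∂ν, |f y| ≤ M

lemma IsEssBddBy.neg {ν : Measure X} {M : ℝ} {f : X → ℝ} (hf : IsEssBddBy ν M f) :
    IsEssBddBy ν M (fun y => -f y) :=
  ⟨hf.measurable.neg, by simpa using hf.ae_le⟩

lemma IsEssBddBy.add {ν : Measure X} {M N : ℝ} {f g : X → ℝ} (hf : IsEssBddBy ν M f)
    (hg : IsEssBddBy ν N g) : IsEssBddBy ν (M + N) (fun y => f y + g y) := by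
  refine ⟨hf.measurable.add hg.measurable, ?_⟩
  filter_upwards [hf.ae_le, hg.ae_le] with y h1 h2
  exact (abs_add_le _ _).trans (add_le_add h1 h2)

lemma IsEssBddBy.const_mul {ν : Measure X} {M : ℝ} {f : X → ℝ} (hf : IsEssBddBy ν M f)
    {c : ℝ} (hc : 0 ≤ c) : IsEssBddBy ν (c * M) (fun y => c * f y) := by
  refine ⟨hf.measurable.const_mul c, ?_⟩
  filter_upwards [hf.ae_le] with y h1
  rw [abs_mul, abs_of_nonneg hc]
  exact mul_le_mul_of_nonneg_left h1 hc

lemma isEssBddBy_coeFn {ν : Measure X} (u : Lp ℝ ∞ ν) : IsEssBddBy ν ‖u‖ u := by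
  refine ⟨(Lp.stronglyMeasurable u).measurable, ?_⟩
  filter_upwards [ae_le_eLpNormEssSup (f := u) (μ := ν)] with y hy
  rw [← eLpNorm_exponent_top] at hy
  have := ENNReal.toReal_mono (Lp.eLpNorm_ne_top u) hy
  simpa [Lp.norm_def] using this

lemma IsEssBddBy.integrable {ν m : Measure X} [IsFiniteMeasure m] (hm : m ≪ ν) {M : ℝ}
    {f : X → ℝ} (hf : IsEssBddBy ν M f) : Integrable f m :=
  Integrable.of_bound hf.measurable.aestronglyMeasurable M (hm.ae_le hf.ae_le)

end

noncomputable section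

variable {X : Type*} [MetricSpace X] [MeasurableSpace X]

/-! ### Essential suprema over balls -/

/-- The `ν`-essential supremum of `f` over the open ball `B_r(x)`, taken in the extended reals.
It is `⊥` if the ball is a null set. -/
def ballEssSup (ν : Measure X) (r : ℝ) (f : X → ℝ) (x : X) : EReal :=
  essSup (fun y => (f y : EReal)) (ν.restrict (Metric.ball x r))

lemma ballEssSup_le_iff {ν : Measure X} {r : ℝ} {f : X → ℝ} {x : X} {a : EReal} :
    ballEssSup ν r f x ≤ a ↔ ∀ᵐ y ∂ν.restrict (Metric.ball x r), (f y : EReal) ≤ a :=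
  ⟨fun h => by
    filter_upwards [ae_le_essSup (μ := ν.restrict (Metric.ball x r))
      (f := fun y => (f y : EReal))] with y hy
    exact hy.trans h, fun h => essSup_le_of_ae_le a h⟩

lemma ae_le_ballEssSup_of_mem_ball (ν : Measure X) (r : ℝ) (f : X → ℝ) (x : X) :
    ∀ᵐ y ∂ν.restrict (Metric.ball x r), (f y : EReal) ≤ ballEssSup ν r f x :=
  ballEssSup_le_iff.1 le_rfl

lemma ballEssSup_congr {ν : Measure X} {f g : X → ℝ} (h : f =ᵐ[ν] g) (r : ℝ) :
    ballEssSup ν r f = ballEssSup ν r g := by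
  funext x
  refine essSup_congr_ae ?_
  filter_upwards [ae_restrict_of_ae h] with y hy
  rw [hy]

lemma ballEssSup_mono {ν : Measure X} {f : X → ℝ} {x y : X} {r s : ℝ}
    (h : Metric.ball y s ⊆ Metric.ball x r) : ballEssSup ν s f y ≤ ballEssSup ν r f x :=
  essSup_mono_measure' (Measure.restrict_mono h le_rfl)

lemma ballEssSup_le_iSup {ν : Measure X} {r : ℝ} {f v : X → ℝ}
    [OpensMeasurableSpace X] (h : v =ᵐ[ν] f) (x : X) :
    ballEssSup ν r f x ≤ ⨆ y ∈ Metric.ball x r, (v y : EReal) := by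
  rw [ballEssSup_le_iff]
  filter_upwards [ae_restrict_of_ae h, ae_restrict_mem Metric.isOpen_ball.measurableSet]
    with y hy hyb
  rw [← hy]
  exact le_iSup₂ (f := fun y (_ : y ∈ Metric.ball x r) => (v y : EReal)) y hyb

/-- A function is a.e. dominated by its essential suprema over balls of a fixed radius. No
differentiation theorem is needed: countably many balls of half the radius cover the space. -/
lemma ae_le_ballEssSup [TopologicalSpace.SeparableSpace X] [OpensMeasurableSpace X]
    (ν : Measure X) {r : ℝ} (hr : 0 < r) (f : X → ℝ) :
    ∀ᵐ y ∂ν, (f y : EReal) ≤ ballEssSup ν r f y := by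
  obtain ⟨D, hDc, hD⟩ := TopologicalSpace.exists_countable_dense X
  have h : ∀ᵐ y ∂ν, ∀ d ∈ D, y ∈ Metric.ball d (r / 2) →
      (f y : EReal) ≤ ballEssSup ν (r / 2) f d := by
    rw [ae_ball_iff hDc]
    intro d _
    exact (ae_restrict_iff' Metric.isOpen_ball.measurableSet).1
      (ae_le_ballEssSup_of_mem_ball ν (r / 2) f d)
  filter_upwards [h] with y hy
  obtain ⟨d, hd, hyd⟩ := hD.exists_dist_lt y (half_pos hr)
  refine (hy d hd hyd).trans (ballEssSup_mono (Metric.ball_subset_ball' ?_))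
  rw [dist_comm]
  linarith

lemma measurable_ballEssSup [TopologicalSpace.SeparableSpace X] [BorelSpace X]
    (ν : Measure X) [SFinite ν] (r : ℝ) {f : X → ℝ} (hf : Measurable f) :
    Measurable (ballEssSup ν r f) := by
  have : SecondCountableTopology X := UniformSpace.secondCountable_of_separable X
  refine measurable_of_Iic fun a => ?_
  have hset : MeasurableSet {p : X × X | dist p.2 p.1 < r ∧ ¬ (f p.2 : EReal) ≤ a} := by
    refine (measurableSet_lt (measurable_snd.dist measurable_fst) measurable_const).inter ?_
    exact (measurableSet_le (hf.comp measurable_snd).coe_real_ereal measurable_const).compl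
  have hmeas := measurable_measure_prodMk_left (ν := ν) hset
  convert hmeas (measurableSet_singleton 0) using 1
  ext x
  simp only [mem_preimage, mem_Iic, mem_singleton_iff, ballEssSup_le_iff]
  rw [ae_restrict_iff' Metric.isOpen_ball.measurableSet, ae_iff]
  simp only [Classical.not_imp, Metric.mem_ball]
  rfl

/-- The real-valued version of `ballEssSup`; it agrees with it for essentially bounded `f` at points
`x` with `ν (B_r(x)) ≠ 0`. -/
def ballSup (ν : Measure X) (r : ℝ) (f : X → ℝ) (x : X) : ℝ :=
  (ballEssSup ν r f x).toReal

lemma ballEssSup_mem_Icc {ν : Measure X} {M r : ℝ} {f : X → ℝ} (hf : IsEssBddBy ν M f) {x : X}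
    (hx : ν (Metric.ball x r) ≠ 0) : ballEssSup ν r f x ∈ Icc (-M : EReal) M := by
  constructor
  · have : (ae (ν.restrict (Metric.ball x r))).NeBot := by simpa [ae_neBot] using hx
    obtain ⟨y, h1, h2⟩ := ((ae_restrict_of_ae hf.ae_le).and
      (ae_le_ballEssSup_of_mem_ball ν r f x)).exists
    refine le_trans ?_ h2
    exact_mod_cast (abs_le.1 h1).1
  · rw [ballEssSup_le_iff]
    filter_upwards [ae_restrict_of_ae hf.ae_le] with y hy
    exact_mod_cast (abs_le.1 hy).2

lemma coe_ballSup {ν : Measure X} {M r : ℝ} {f : X → ℝ} (hf : IsEssBddBy ν M f) {x : X}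
    (hx : ν (Metric.ball x r) ≠ 0) : (ballSup ν r f x : EReal) = ballEssSup ν r f x := by
  obtain ⟨h1, h2⟩ := ballEssSup_mem_Icc hf hx
  exact EReal.coe_toReal (ne_top_of_le_ne_top (EReal.coe_ne_top M) h2)
    (ne_bot_of_le_ne_bot (EReal.coe_ne_bot (-M)) h1)

lemma abs_ballSup_le {ν : Measure X} {M r : ℝ} {f : X → ℝ} (hf : IsEssBddBy ν M f) {x : X}
    (hx : ν (Metric.ball x r) ≠ 0) : |ballSup ν r f x| ≤ M := by
  obtain ⟨h1, h2⟩ := ballEssSup_mem_Icc hf hx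
  rw [← coe_ballSup hf hx] at h1 h2
  exact abs_le.2 ⟨by exact_mod_cast h1, by exact_mod_cast h2⟩

lemma ballSup_le_iff {ν : Measure X} {M r : ℝ} {f : X → ℝ} (hf : IsEssBddBy ν M f) {x : X}
    (hx : ν (Metric.ball x r) ≠ 0) {a : ℝ} :
    ballSup ν r f x ≤ a ↔ ∀ᵐ y ∂ν.restrict (Metric.ball x r), f y ≤ a := by
  rw [← EReal.coe_le_coe_iff, coe_ballSup hf hx, ballEssSup_le_iff]
  simp

lemma ballSup_congr {ν : Measure X} {f g : X → ℝ} (h : f =ᵐ[ν] g) (r : ℝ) :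
    ballSup ν r f = ballSup ν r g := by
  funext x
  rw [ballSup, ballSup, ballEssSup_congr h]

lemma ballSup_const_mul {ν : Measure X} {M r c : ℝ} (hc : 0 ≤ c) {f : X → ℝ}
    (hf : IsEssBddBy ν M f) {x : X} (hx : ν (Metric.ball x r) ≠ 0) :
    ballSup ν r (fun y => c * f y) x = c * ballSup ν r f x := by
  refine eq_of_forall_ge_iff fun a => ?_
  rw [ballSup_le_iff (hf.const_mul hc) hx]
  rcases hc.eq_or_lt with rfl | hc
  · have : (ae (ν.restrict (Metric.ball x r))).NeBot := by simpa [ae_neBot] using hx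
    simp
  · rw [mul_comm, ← le_div_iff₀ hc, ballSup_le_iff hf hx]
    simp_rw [le_div_iff₀ hc, mul_comm c]

lemma ballSup_add_le {ν : Measure X} {M N r : ℝ} {f g : X → ℝ}
    (hf : IsEssBddBy ν M f) (hg : IsEssBddBy ν N g) {x : X} (hx : ν (Metric.ball x r) ≠ 0) :
    ballSup ν r (fun y => f y + g y) x ≤ ballSup ν r f x + ballSup ν r g x := by
  rw [ballSup_le_iff (hf.add hg) hx]
  filter_upwards [(ballSup_le_iff hf hx).1 le_rfl, (ballSup_le_iff hg hx).1 le_rfl] with y h1 h2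
  exact add_le_add h1 h2

lemma measurable_ballSup [TopologicalSpace.SeparableSpace X] [BorelSpace X]
    (ν : Measure X) [SFinite ν] (r : ℝ) {f : X → ℝ} (hf : Measurable f) :
    Measurable (ballSup ν r f) :=
  (measurable_ballEssSup ν r hf).ereal_toReal

/-! ### The optimal representative -/

/-- The limit of `ballEssSup ν r f x` as `r` decreases to `0`. As `ballEssSup` is monotone in the
radius, it is the infimum over the radii `1 / (n + 1)`. -/
def localEssSup (ν : Measure X) (f : X → ℝ) (x : X) : EReal :=
  ⨅ n : ℕ, ballEssSup ν (1 / (n + 1)) f x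

/-- The representative of `f` that lies between its local essential infimum and its local essential
supremum at every point of the support of `ν`: the value `f x`, raised to the former and then cut
off at the latter. For essentially bounded `f` the result is finite on the support; elsewhere
`toReal` may replace an infinite value by `0`. -/
def optRep (ν : Measure X) (f : X → ℝ) (x : X) : ℝ :=
  (min (localEssSup ν f x)
    (max (f x : EReal) (-localEssSup ν (fun y => -f y) x))).toReal

lemma measurable_optRep [TopologicalSpace.SeparableSpace X] [BorelSpace X]
    (ν : Measure X) [SFinite ν] {f : X → ℝ} (hf : Measurable f) :
    Measurable (optRep ν f) := by
  have h (g : X → ℝ) (hg : Measurable g) : Measurable (localEssSup ν g) :=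
    Measurable.iInf fun n => measurable_ballEssSup ν _ hg
  exact ((h f hf).min (hf.coe_real_ereal.max (h _ hf.neg).neg)).ereal_toReal

lemma ae_le_localEssSup [TopologicalSpace.SeparableSpace X] [BorelSpace X]
    (ν : Measure X) (f : X → ℝ) :
    ∀ᵐ y ∂ν, (f y : EReal) ≤ localEssSup ν f y := by
  have : ∀ᵐ y ∂ν, ∀ n : ℕ, (f y : EReal) ≤ ballEssSup ν (1 / (n + 1)) f y :=
    ae_all_iff.2 fun n => ae_le_ballEssSup ν Nat.one_div_pos_of_nat f
  filter_upwards [this] with y hy using le_iInf hy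

lemma optRep_ae_eq [TopologicalSpace.SeparableSpace X] [BorelSpace X]
    (ν : Measure X) (f : X → ℝ) : optRep ν f =ᵐ[ν] f := by
  filter_upwards [ae_le_localEssSup ν f, ae_le_localEssSup ν (fun y => -f y)] with y h1 h2
  have h2' : -localEssSup ν (fun y => -f y) y ≤ (f y : EReal) := by
    rw [EReal.neg_le]
    exact_mod_cast h2
  rw [optRep, max_eq_left h2', min_eq_right h1, EReal.toReal_coe]

lemma localEssSup_le {ν : Measure X} {f : X → ℝ} {x y : X} {r : ℝ} (hy : y ∈ Metric.ball x r) :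
    localEssSup ν f y ≤ ballEssSup ν r f x := by
  obtain ⟨n, hn⟩ := exists_nat_one_div_lt (sub_pos.2 (Metric.mem_ball.1 hy))
  refine (iInf_le _ n).trans (ballEssSup_mono (Metric.ball_subset_ball' ?_))
  linarith

lemma neg_localEssSup_neg_le {ν : Measure X} {f : X → ℝ} {y : X} (hy : y ∈ ν.support) :
    -localEssSup ν (fun y => -f y) y ≤ localEssSup ν f y := by
  rw [EReal.neg_le]
  refine le_iInf fun n => ?_
  rw [EReal.neg_le]
  refine le_iInf fun k => ?_
  rw [EReal.neg_le]
  -- compare the two essential suprema at a common point of the smaller ball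
  set r : ℝ := min (1 / (n + 1)) (1 / (k + 1)) with hr
  have hr0 : 0 < r := lt_min Nat.one_div_pos_of_nat Nat.one_div_pos_of_nat
  have hne : ν (Metric.ball y r) ≠ 0 :=
    ((Measure.mem_support_iff_forall y).1 hy _ (Metric.ball_mem_nhds y hr0)).ne'
  have : (ae (ν.restrict (Metric.ball y r))).NeBot := by simpa [ae_neBot] using hne
  obtain ⟨z, h1, h2⟩ := ((ae_le_ballEssSup_of_mem_ball ν r f y).and
    (ae_le_ballEssSup_of_mem_ball ν r (fun y => -f y) y)).exists
  have h1' := h1.trans (ballEssSup_mono (Metric.ball_subset_ball (min_le_right _ _)))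
  have h2' := h2.trans (ballEssSup_mono (Metric.ball_subset_ball (min_le_left _ _)))
  refine le_trans ?_ h2'
  rw [EReal.coe_neg, EReal.neg_le_neg_iff]
  exact h1'

lemma optRep_mem_Icc {ν : Measure X} {M : ℝ} {f : X → ℝ} (hf : IsEssBddBy ν M f) {y : X}
    (hy : y ∈ ν.support) :
    (optRep ν f y : EReal) ∈ Icc (-localEssSup ν (fun y => -f y) y) (localEssSup ν f y) := by
  have hne (r : ℝ) (hr : 0 < r) : ν (Metric.ball y r) ≠ 0 :=
    ((Measure.mem_support_iff_forall y).1 hy _ (Metric.ball_mem_nhds y hr)).ne'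
  have hle (g : X → ℝ) (hg : IsEssBddBy ν M g) : localEssSup ν g y ≤ M :=
    (localEssSup_le (Metric.mem_ball_self one_pos)).trans
      (ballEssSup_mem_Icc hg (hne 1 one_pos)).2
  have h0 := neg_localEssSup_neg_le (f := f) hy
  have h1 := hle f hf
  have h2 : (-M : EReal) ≤ -localEssSup ν (fun y => -f y) y :=
    EReal.neg_le_neg_iff.2 (hle _ hf.neg)
  have h3 : -localEssSup ν (fun y => -f y) y ≤ min (localEssSup ν f y)
      (max (f y : EReal) (-localEssSup ν (fun y => -f y) y)) := le_min h0 (le_max_right _ _)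
  rw [optRep, EReal.coe_toReal
    (ne_top_of_le_ne_top (EReal.coe_ne_top M) ((min_le_left _ _).trans h1))
    (ne_bot_of_le_ne_bot (EReal.coe_ne_bot (-M)) (h2.trans h3))]
  exact ⟨h3, min_le_left _ _⟩

/-- Over a ball contained in the support of `ν`, the pointwise supremum of the optimal
representative does not exceed the essential supremum. -/
lemma iSup_optRep_le {ν : Measure X} {M r : ℝ} {f : X → ℝ} (hf : IsEssBddBy ν M f) {x : X}
    (hx : Metric.ball x r ⊆ ν.support) :
    ⨆ y ∈ Metric.ball x r, (optRep ν f y : EReal) ≤ ballEssSup ν r f x :=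
  iSup₂_le fun _ hy => (optRep_mem_Icc hf (hx hy)).2.trans (localEssSup_le hy)

lemma iSup_neg_optRep_le {ν : Measure X} {M r : ℝ} {f : X → ℝ} (hf : IsEssBddBy ν M f) {x : X}
    (hx : Metric.ball x r ⊆ ν.support) :
    ⨆ y ∈ Metric.ball x r, ((-optRep ν f y : ℝ) : EReal) ≤
      ballEssSup ν r (fun y => -f y) x :=
  iSup₂_le fun y hy => by
    refine le_trans ?_ (localEssSup_le hy)
    rw [EReal.coe_neg, EReal.neg_le]
    exact (optRep_mem_Icc hf (hx hy)).1

end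

noncomputable section

variable {X : Type*} [MetricSpace X] [MeasurableSpace X]

/-! ### The one-sided functional -/

/-- The one-sided functional `∫ (ess sup_{B_ε(x)} f - f x) dm(x)`, built on `ν`-essential suprema.
If `m ≪ ν` and `0 < ε`, the difference is nonnegative for `m`-almost every `x` with
`ν (B_ε(x)) ≠ 0`, so `ofReal` truncates nothing there. -/
def gapIntegral (ν m : Measure X) (ε : ℝ) (f : X → ℝ) : ℝ≥0∞ :=
  ∫⁻ x, ENNReal.ofReal (ballSup ν ε f x - f x) ∂m

lemma gapIntegral_congr {ν m : Measure X} (hm : m ≪ ν) (ε : ℝ) {f g : X → ℝ} (h : f =ᵐ[ν] g) :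
    gapIntegral ν m ε f = gapIntegral ν m ε g := by
  rw [gapIntegral, gapIntegral, ballSup_congr h]
  refine lintegral_congr_ae ?_
  filter_upwards [hm.ae_eq h] with x hx
  rw [hx]

lemma gapIntegral_lt_top {ν m : Measure X} [IsFiniteMeasure m] (hm : m ≪ ν) {ε M : ℝ}
    (hball : ∀ᵐ x ∂m, ν (Metric.ball x ε) ≠ 0) {f : X → ℝ} (hf : IsEssBddBy ν M f) :
    gapIntegral ν m ε f < ∞ := by
  have h : gapIntegral ν m ε f ≤ ∫⁻ _, ENNReal.ofReal (M + M) ∂m := by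
    refine lintegral_mono_ae ?_
    filter_upwards [hball, hm.ae_le hf.ae_le] with x hx hfx
    have h1 := (abs_le.1 (abs_ballSup_le hf hx)).2
    have h2 := (abs_le.1 hfx).1
    exact ENNReal.ofReal_le_ofReal (by linarith)
  refine h.trans_lt ?_
  rw [lintegral_const]
  exact ENNReal.mul_lt_top ENNReal.ofReal_lt_top (measure_lt_top m univ)

lemma gapIntegral_const_mul {ν m : Measure X} {ε M : ℝ}
    (hball : ∀ᵐ x ∂m, ν (Metric.ball x ε) ≠ 0) {f : X → ℝ} (hf : IsEssBddBy ν M f) (c : ℝ≥0) :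
    gapIntegral ν m ε (fun x => c * f x) = c * gapIntegral ν m ε f := by
  rw [gapIntegral, gapIntegral, ← lintegral_const_mul' _ _ ENNReal.coe_ne_top]
  refine lintegral_congr_ae ?_
  filter_upwards [hball] with x hx
  rw [ballSup_const_mul c.coe_nonneg hf hx, ← mul_sub, ENNReal.ofReal_mul c.coe_nonneg,
    ENNReal.ofReal_coe_nnreal]

lemma gapIntegral_add_le [TopologicalSpace.SeparableSpace X] [BorelSpace X] {ν m : Measure X}
    [SFinite ν] {ε M N : ℝ} (hball : ∀ᵐ x ∂m, ν (Metric.ball x ε) ≠ 0) {f g : X → ℝ}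
    (hf : IsEssBddBy ν M f) (hg : IsEssBddBy ν N g) :
    gapIntegral ν m ε (fun x => f x + g x) ≤ gapIntegral ν m ε f + gapIntegral ν m ε g := by
  have hmeas : Measurable fun x => ENNReal.ofReal (ballSup ν ε f x - f x) :=
    ((measurable_ballSup ν ε hf.measurable).sub hf.measurable).ennreal_ofReal
  rw [gapIntegral, gapIntegral, gapIntegral, ← lintegral_add_left hmeas]
  refine lintegral_mono_ae ?_
  filter_upwards [hball] with x hx
  refine (ENNReal.ofReal_le_ofReal ?_).trans ENNReal.ofReal_add_le
  linarith [ballSup_add_le hf hg hx]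

lemma gapIntegral_convex [TopologicalSpace.SeparableSpace X] [BorelSpace X] {ν m : Measure X}
    [SFinite ν] {ε M N : ℝ} (hball : ∀ᵐ x ∂m, ν (Metric.ball x ε) ≠ 0) {f g : X → ℝ}
    (hf : IsEssBddBy ν M f) (hg : IsEssBddBy ν N g) (a b : ℝ≥0) :
    gapIntegral ν m ε (fun x => a * f x + b * g x) ≤
      a * gapIntegral ν m ε f + b * gapIntegral ν m ε g := by
  rw [← gapIntegral_const_mul hball hf, ← gapIntegral_const_mul hball hg]
  exact gapIntegral_add_le hball (hf.const_mul a.coe_nonneg) (hg.const_mul b.coe_nonneg)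

/-! ### Weak-* lower semicontinuity of the one-sided functional -/

/-- The essential supremum over a ball is lower semicontinuous with respect to convergence of the
integrals over all Borel sets. -/
lemma eventually_lt_ballSup [OpensMeasurableSpace X] {ν : Measure X} [IsFiniteMeasure ν]
    {ε M : ℝ} {f : ℕ → X → ℝ} {g : X → ℝ} (hf : ∀ k, IsEssBddBy ν M (f k)) (hg : IsEssBddBy ν M g)
    (hlim : ∀ A, MeasurableSet A →
      Tendsto (fun k => ∫ x in A, f k x ∂ν) atTop (𝓝 (∫ x in A, g x ∂ν)))
    {x : X} (hx : ν (Metric.ball x ε) ≠ 0) {a : ℝ} (ha : a < ballSup ν ε g x) :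
    ∀ᶠ k in atTop, a < ballSup ν ε (f k) x := by
  -- test against the indicator of the part of the ball where `g` exceeds `a`
  set A : Set X := Metric.ball x ε ∩ {y | a < g y} with hA
  have hAm : MeasurableSet A :=
    Metric.isOpen_ball.measurableSet.inter (measurableSet_lt measurable_const hg.measurable)
  have hA0 : ν A ≠ 0 := by
    intro h0
    refine ha.not_ge ((ballSup_le_iff hg hx).2 ?_)
    rw [ae_restrict_iff' Metric.isOpen_ball.measurableSet, ae_iff]
    convert h0 using 2
    ext y
    simp [hA]
  have hint (h : X → ℝ) (hh : IsEssBddBy ν M h) : IntegrableOn h A ν :=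
    (hh.integrable Measure.AbsolutelyContinuous.rfl).integrableOn
  have hlt : a * ν.real A < ∫ y in A, g y ∂ν := by
    have h0 : 0 < ∫ y in A, (g y - a) ∂ν := by
      rw [setIntegral_pos_iff_support_of_nonneg_ae]
      · refine (pos_iff_ne_zero.2 hA0).trans_le (measure_mono fun y hy => ⟨?_, hy⟩)
        exact (sub_pos.2 hy.2).ne'
      · filter_upwards [ae_restrict_mem hAm] with y hy
        exact (sub_pos.2 hy.2).le
      · exact (hint g hg).sub (integrable_const a)
    rw [integral_sub (hint g hg) (integrable_const a), setIntegral_const, smul_eq_mul] at h0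
    linarith
  filter_upwards [(hlim A hAm).eventually (lt_mem_nhds hlt)] with k hk
  by_contra hcon
  have hle := (ballSup_le_iff (hf k) hx).1 (not_lt.1 hcon)
  have : ∫ y in A, f k y ∂ν ≤ ∫ _ in A, a ∂ν :=
    integral_mono_ae (hint _ (hf k)) (integrable_const a)
      (ae_restrict_of_ae_restrict_of_subset inter_subset_left hle)
  rw [setIntegral_const, smul_eq_mul] at this
  linarith

lemma ballSup_sub_nonneg_ae [TopologicalSpace.SeparableSpace X] [OpensMeasurableSpace X]
    {ν m : Measure X} (hm : m ≪ ν) {ε M : ℝ} (hε : 0 < ε) (hball : ∀ᵐ x ∂m, ν (Metric.ball x ε) ≠ 0)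
    {f : X → ℝ} (hf : IsEssBddBy ν M f) : ∀ᵐ x ∂m, 0 ≤ ballSup ν ε f x - f x := by
  filter_upwards [hball, hm.ae_le (ae_le_ballEssSup ν hε f)] with x hx h
  rw [← coe_ballSup hf hx, EReal.coe_le_coe_iff] at h
  linarith

/-- The integrands on the left are nonnegative almost everywhere, so no mass is lost to `ofReal`. -/
lemma gapIntegral_add_lintegral [TopologicalSpace.SeparableSpace X] [BorelSpace X]
    {ν m : Measure X} (hm : m ≪ ν) {ε M : ℝ} (hε : 0 < ε)
    (hball : ∀ᵐ x ∂m, ν (Metric.ball x ε) ≠ 0) {f : X → ℝ} (hf : IsEssBddBy ν M f) :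
    gapIntegral ν m ε f + ∫⁻ x, ENNReal.ofReal (f x + M) ∂m =
      ∫⁻ x, ENNReal.ofReal (ballSup ν ε f x + M) ∂m := by
  rw [gapIntegral, ← lintegral_add_right _ (hf.measurable.add_const M).ennreal_ofReal]
  refine lintegral_congr_ae ?_
  filter_upwards [ballSup_sub_nonneg_ae hm hε hball hf, hm.ae_le hf.ae_le] with x h1 h2
  rw [← ENNReal.ofReal_add h1 (by linarith [(abs_le.1 h2).1])]
  congr 1
  ring

/-- Lower semicontinuity along a bounded sequence: the essential suprema, shifted by the bound `M`
to make them nonnegative, are handled by Fatou's lemma, and the linear terms converge. -/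
lemma gapIntegral_le_liminf [TopologicalSpace.SeparableSpace X] [BorelSpace X]
    {ν m : Measure X} [IsFiniteMeasure ν] [IsFiniteMeasure m] (hm : m ≪ ν) {ε M : ℝ} (hε : 0 < ε)
    (hball : ∀ᵐ x ∂m, ν (Metric.ball x ε) ≠ 0) {f : ℕ → X → ℝ} {g : X → ℝ}
    (hf : ∀ k, IsEssBddBy ν M (f k)) (hg : IsEssBddBy ν M g)
    (hlim : ∀ A, MeasurableSet A →
      Tendsto (fun k => ∫ x in A, f k x ∂ν) atTop (𝓝 (∫ x in A, g x ∂ν)))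
    (hlim' : Tendsto (fun k => ∫ x, f k x ∂m) atTop (𝓝 (∫ x, g x ∂m))) :
    gapIntegral ν m ε g ≤ liminf (fun k => gapIntegral ν m ε (f k)) atTop := by
  have hc (h : X → ℝ) (hh : IsEssBddBy ν M h) : ∫⁻ x, ENNReal.ofReal (h x + M) ∂m =
      ENNReal.ofReal (∫ x, h x ∂m + ∫ _, M ∂m) := by
    have hint : Integrable (fun x => h x + M) m := (hh.integrable hm).add (integrable_const M)
    rw [← integral_add (hh.integrable hm) (integrable_const M),
      ofReal_integral_eq_lintegral_ofReal hint]
    filter_upwards [hm.ae_le hh.ae_le] with x hx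
    simpa using by linarith [(abs_le.1 hx).1]
  set c : ℝ≥0∞ := ∫⁻ x, ENNReal.ofReal (g x + M) ∂m with hcdef
  have hctop : c ≠ ∞ := by rw [hcdef, hc g hg]; exact ENNReal.ofReal_ne_top
  have hctend : Tendsto (fun k => ∫⁻ x, ENNReal.ofReal (f k x + M) ∂m) atTop (𝓝 c) := by
    simp_rw [hcdef, hc g hg, fun k => hc (f k) (hf k)]
    exact ENNReal.tendsto_ofReal (hlim'.add_const _)
  have hfatou : ∫⁻ x, ENNReal.ofReal (ballSup ν ε g x + M) ∂m ≤
      liminf (fun k => ∫⁻ x, ENNReal.ofReal (ballSup ν ε (f k) x + M) ∂m) atTop := by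
    refine le_trans (lintegral_mono_ae ?_) (lintegral_liminf_le fun k =>
      ((measurable_ballSup ν ε (hf k).measurable).add_const M).ennreal_ofReal)
    filter_upwards [hball] with x hx
    refine le_of_forall_lt fun b hb => ?_
    lift b to ℝ≥0 using hb.ne_top
    obtain ⟨b', hbb', hb'⟩ := exists_between hb
    lift b' to ℝ≥0 using hb'.ne_top
    have key := eventually_lt_ballSup hf hg hlim hx (a := b' - M) (by
      rw [← ENNReal.ofReal_coe_nnreal, ENNReal.ofReal_lt_ofReal_iff'] at hb'
      linarith [hb'.1])
    refine hbb'.trans_le (le_liminf_of_le (by isBoundedDefault) ?_)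
    filter_upwards [key] with k hk
    rw [← ENNReal.ofReal_coe_nnreal]
    exact ENNReal.ofReal_le_ofReal (by linarith)
  have hsplit (k : ℕ) := gapIntegral_add_lintegral hm hε hball (hf k)
  simp_rw [← gapIntegral_add_lintegral hm hε hball hg, ← hsplit] at hfatou
  refine ENNReal.le_of_forall_pos_le_add fun δ hδ _ => ?_
  have hδ' : c < c + δ := ENNReal.lt_add_right hctop (by simpa using hδ.ne')
  have h1 : gapIntegral ν m ε g + c ≤
      liminf (fun k => gapIntegral ν m ε (f k)) atTop + (c + δ) := by
    rw [← liminf_add_const _ _ _ (by isBoundedDefault) (by isBoundedDefault)]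
    refine hfatou.trans (liminf_le_liminf ?_)
    filter_upwards [hctend.eventually (gt_mem_nhds hδ')] with k hk
    exact add_le_add le_rfl hk.le
  rw [add_comm c, ← add_assoc] at h1
  exact (ENNReal.add_le_add_iff_right hctop).1 h1

end

section

variable {X : Type*} [MeasurableSpace X]

/-! ### Weak-* convergence -/

/-- Weak-* convergence, tested against an integrable function rather than its class in `L¹`. -/
lemma WeakStarTendsto.tendsto_integral_mul {ν : Measure X} {u : ℕ → Lp ℝ ∞ ν} {u₀ : Lp ℝ ∞ ν}
    (h : WeakStarTendsto ν u u₀) {φ : X → ℝ} (hφ : Integrable φ ν) :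
    Tendsto (fun k => ∫ x, u k x * φ x ∂ν) atTop (𝓝 (∫ x, u₀ x * φ x ∂ν)) := by
  have hcongr (w : Lp ℝ ∞ ν) : ∫ x, w x * hφ.toL1 φ x ∂ν = ∫ x, w x * φ x ∂ν := by
    refine integral_congr_ae ?_
    filter_upwards [hφ.coeFn_toL1] with x hx
    rw [hx]
  simpa only [hcongr] using h (hφ.toL1 φ)

lemma WeakStarTendsto.tendsto_setIntegral {ν : Measure X} [IsFiniteMeasure ν]
    {u : ℕ → Lp ℝ ∞ ν} {u₀ : Lp ℝ ∞ ν} (h : WeakStarTendsto ν u u₀) {A : Set X}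
    (hA : MeasurableSet A) :
    Tendsto (fun k => ∫ x in A, u k x ∂ν) atTop (𝓝 (∫ x in A, u₀ x ∂ν)) := by
  have hcongr (w : Lp ℝ ∞ ν) : ∫ x, w x * A.indicator (fun _ => (1 : ℝ)) x ∂ν =
      ∫ x in A, w x ∂ν := by
    rw [← integral_indicator hA]
    congr 1 with x
    by_cases hx : x ∈ A <;> simp [hx]
  simpa only [hcongr] using h.tendsto_integral_mul ((integrable_const (1 : ℝ)).indicator hA)

/-- Weak-* convergent sequences have convergent integrals with respect to every finite measure
`m ≪ ν`: test with the density of `m`. -/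
lemma WeakStarTendsto.tendsto_integral {ν m : Measure X} [IsFiniteMeasure ν] [IsFiniteMeasure m]
    (hm : m ≪ ν) {u : ℕ → Lp ℝ ∞ ν} {u₀ : Lp ℝ ∞ ν} (h : WeakStarTendsto ν u u₀) :
    Tendsto (fun k => ∫ x, u k x ∂m) atTop (𝓝 (∫ x, u₀ x ∂m)) := by
  have hcongr (w : Lp ℝ ∞ ν) : ∫ x, w x * (m.rnDeriv ν x).toReal ∂ν = ∫ x, w x ∂m := by
    simp_rw [mul_comm (w _)]
    exact integral_toReal_rnDeriv_mul hm
  simpa only [hcongr] using h.tendsto_integral_mul (Measure.integrable_toReal_rnDeriv (μ := m))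

/-- A function whose integrals satisfy `∫_A f ≤ C ν(A)` for all Borel sets `A` is at most `C`
almost everywhere. -/
lemma ae_le_of_setIntegral_le {ν : Measure X} [IsFiniteMeasure ν] {f : X → ℝ} {C : ℝ}
    (hf : Integrable f ν)
    (h : ∀ A, MeasurableSet A → ∫ x in A, f x ∂ν ≤ C * ν.real A) : ∀ᵐ x ∂ν, f x ≤ C := by
  refine ae_le_of_forall_setIntegral_le hf (integrable_const C) fun A hA _ => ?_
  rw [setIntegral_const, smul_eq_mul, mul_comm]
  exact h A hA

/-- Weak-* convergent sequences are bounded: Banach–Steinhaus for the functionals induced on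
`L¹`. -/
lemma WeakStarTendsto.exists_isEssBddBy {ν : Measure X} [IsFiniteMeasure ν]
    {u : ℕ → Lp ℝ ∞ ν} {u₀ : Lp ℝ ∞ ν} (h : WeakStarTendsto ν u u₀) :
    ∃ M, (∀ k, IsEssBddBy ν M (u k)) ∧ IsEssBddBy ν M u₀ := by
  let g : ℕ → Lp ℝ 1 ν →L[ℝ] ℝ := fun k => (ContinuousLinearMap.mul ℝ ℝ).lpPairing ν ∞ 1 (u k)
  have hg (k : ℕ) (φ : Lp ℝ 1 ν) : g k φ = ∫ x, u k x * φ x ∂ν := by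
    simp only [g, ContinuousLinearMap.lpPairing_eq_integral, ContinuousLinearMap.mul_apply']
  obtain ⟨C, hC⟩ := banach_steinhaus (g := g) fun φ => by
    obtain ⟨C, hC⟩ := (h φ).norm.bddAbove_range
    exact ⟨C, fun k => by rw [hg]; exact hC (mem_range_self k)⟩
  have hint (k : ℕ) : Integrable (u k) ν :=
    (isEssBddBy_coeFn (u k)).integrable Measure.AbsolutelyContinuous.rfl
  have hset (k : ℕ) (A : Set X) (hA : MeasurableSet A) :
      |∫ x in A, u k x ∂ν| ≤ C * ν.real A := by
    have h1 : g k (indicatorConstLp 1 hA (measure_ne_top ν A) (1 : ℝ)) = ∫ x in A, u k x ∂ν := by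
      rw [hg, ← integral_indicator hA]
      refine integral_congr_ae ?_
      filter_upwards [indicatorConstLp_coeFn (p := 1) (hs := hA)
        (hμs := measure_ne_top ν A) (c := (1 : ℝ))] with x hx
      rw [hx]
      by_cases hxA : x ∈ A <;> simp [hxA]
    rw [← h1, ← Real.norm_eq_abs]
    refine ((g k).le_of_opNorm_le (hC k) _).trans_eq ?_
    rw [norm_indicatorConstLp one_ne_zero ENNReal.one_ne_top]
    simp
  have hbdd (k : ℕ) : IsEssBddBy ν C (u k) := by
    refine ⟨(isEssBddBy_coeFn (u k)).measurable, ?_⟩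
    have h1 := ae_le_of_setIntegral_le (hint k) fun A hA => (abs_le.1 (hset k A hA)).2
    have h2 := ae_le_of_setIntegral_le (hint k).neg fun A hA => by
      simp only [Pi.neg_apply, integral_neg]
      linarith [(abs_le.1 (hset k A hA)).1]
    filter_upwards [h1, h2] with x hx1 hx2
    exact abs_le.2 ⟨by simp only [Pi.neg_apply] at hx2; linarith, hx1⟩
  refine ⟨max C ‖u₀‖, fun k => ⟨(hbdd k).measurable, ?_⟩,
    ⟨(isEssBddBy_coeFn u₀).measurable, ?_⟩⟩
  · filter_upwards [(hbdd k).ae_le] with x hx using hx.trans (le_max_left _ _)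
  · filter_upwards [(isEssBddBy_coeFn u₀).ae_le] with x hx using hx.trans (le_max_right _ _)

/-! ### The total variation in terms of essential suprema -/

/-- The part of the first marginal of `μ` that carries the label `i`, that is `w i • ρ i`. -/
noncomputable def labelMeasure (μ : Measure (X × Fin 2)) (i : Fin 2) : Measure X :=
  (μ.restrict (univ ×ˢ {i})).map Prod.fst

instance (μ : Measure (X × Fin 2)) [IsFiniteMeasure μ] (i : Fin 2) :
    IsFiniteMeasure (labelMeasure μ i) := by
  unfold labelMeasure
  infer_instance

lemma labelMeasure_le_fst (μ : Measure (X × Fin 2)) (i : Fin 2) : labelMeasure μ i ≤ μ.fst :=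
  Measure.map_mono Measure.restrict_le_self measurable_fst

lemma classProb_mul_lintegral (μ : Measure (X × Fin 2)) [IsFiniteMeasure μ] (i : Fin 2)
    (ε : ℝ) (f : X → ℝ≥0∞) :
    classProb μ i / ENNReal.ofReal ε * ∫⁻ x, f x ∂(condDistrib μ i) =
      (ENNReal.ofReal ε)⁻¹ * ∫⁻ x, f x ∂(labelMeasure μ i) := by
  rw [condDistrib, lintegral_smul_measure, ← labelMeasure, smul_eq_mul, div_eq_mul_inv,
    mul_comm (classProb μ i), mul_assoc, ← mul_assoc (classProb μ i)]
  by_cases h0 : classProb μ i = 0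
  · have : labelMeasure μ i = 0 := by
      rw [labelMeasure, Measure.restrict_eq_zero.2 h0, Measure.map_zero]
    simp [this]
  · rw [ENNReal.mul_inv_cancel h0 (measure_ne_top μ _), one_mul]

end

section

variable {X : Type*} [MetricSpace X] [MeasurableSpace X]

lemma infGap_eq_supGap_neg {Y : Type*} [MetricSpace Y] (ε : ℝ) (v : Y → ℝ) :
    infGap ε v = supGap ε (fun x => -v x) := by
  funext x
  have h : (⨆ y ∈ Metric.ball x ε, ((-v y : ℝ) : EReal)) =
      -⨅ y ∈ Metric.ball x ε, (v y : EReal) := by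
    refine eq_of_forall_ge_iff fun a => ?_
    simp only [iSup_le_iff, EReal.neg_le, le_iInf_iff, EReal.coe_neg]
  rw [infGap, supGap, h, EReal.coe_neg, sub_eq_add_neg, sub_eq_add_neg, neg_neg, add_comm]

lemma preTV_eq (ε : ℝ) (μ : Measure (X × Fin 2)) [IsFiniteMeasure μ] (v : X → ℝ) :
    preTV ε μ v = (ENNReal.ofReal ε)⁻¹ * (∫⁻ x, supGap ε v x ∂(labelMeasure μ 0) +
      ∫⁻ x, supGap ε (fun x => -v x) x ∂(labelMeasure μ 1)) := by
  rw [preTV, classProb_mul_lintegral, classProb_mul_lintegral, infGap_eq_supGap_neg, mul_add]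

lemma gapIntegral_le_lintegral_supGap [OpensMeasurableSpace X] {ν m : Measure X} (hm : m ≪ ν)
    {ε M : ℝ} (hball : ∀ᵐ x ∂m, ν (Metric.ball x ε) ≠ 0) {f v : X → ℝ}
    (hf : IsEssBddBy ν M f) (hv : v =ᵐ[ν] f) :
    gapIntegral ν m ε f ≤ ∫⁻ x, supGap ε v x ∂m := by
  refine lintegral_mono_ae ?_
  filter_upwards [hball, hm.ae_eq hv] with x hx hvx
  rw [← EReal.real_coe_toENNReal, EReal.coe_sub, coe_ballSup hf hx, supGap, hvx]
  exact EReal.toENNReal_le_toENNReal (EReal.sub_le_sub (ballEssSup_le_iSup hv x) le_rfl)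

lemma lintegral_supGap_le_gapIntegral {ν m : Measure X} (hm : m ≪ ν)
    {ε M : ℝ} (hball : ∀ᵐ x ∂m, ν (Metric.ball x ε) ≠ 0) {f v : X → ℝ}
    (hf : IsEssBddBy ν M f) (hv : v =ᵐ[ν] f)
    (hle : ∀ᵐ x ∂m, ⨆ y ∈ Metric.ball x ε, (v y : EReal) ≤ ballEssSup ν ε f x) :
    ∫⁻ x, supGap ε v x ∂m ≤ gapIntegral ν m ε f := by
  refine lintegral_mono_ae ?_
  filter_upwards [hball, hm.ae_eq hv, hle] with x hx hvx hlex
  rw [← EReal.real_coe_toENNReal, EReal.coe_sub, coe_ballSup hf hx, supGap, hvx]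
  exact EReal.toENNReal_le_toENNReal (EReal.sub_le_sub hlex le_rfl)

section

variable {μ : Measure (X × Fin 2)} {ν : Measure X} {ε : ℝ}

lemma IsReference.labelMeasure_absolutelyContinuous (hν : IsReference ε μ ν) (i : Fin 2) :
    labelMeasure μ i ≪ ν :=
  (labelMeasure_le_fst μ i).absolutelyContinuous.trans hν.fst_absolutelyContinuous

lemma IsReference.ae_ball_subset [TopologicalSpace.SeparableSpace X]
    (hν : IsReference ε μ ν) (i : Fin 2) :
    ∀ᵐ x ∂(labelMeasure μ i), Metric.ball x ε ⊆ ν.support := by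
  have : SecondCountableTopology X := UniformSpace.secondCountable_of_separable X
  have h : ∀ᵐ x ∂μ.fst, x ∈ μ.fst.support := Measure.support_mem_ae
  filter_upwards [(labelMeasure_le_fst μ i).absolutelyContinuous.ae_le h] with x hx
  exact fun y hy => hν.thickening_subset (Metric.mem_thickening_iff.2 ⟨x, hx, hy⟩)

lemma IsReference.ae_ball_ne_zero [TopologicalSpace.SeparableSpace X] (hε : 0 < ε)
    (hν : IsReference ε μ ν) (i : Fin 2) :
    ∀ᵐ x ∂(labelMeasure μ i), ν (Metric.ball x ε) ≠ 0 := by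
  filter_upwards [hν.ae_ball_subset i] with x hx
  exact ((Measure.mem_support_iff_forall x).1 (hx (Metric.mem_ball_self hε)) _
    (Metric.ball_mem_nhds x hε)).ne'

/-- The infimum over representatives amounts to replacing pointwise suprema by essential suprema;
it is attained at `optRep ν u`. -/
lemma IsReference.TV_eq [TopologicalSpace.SeparableSpace X] [BorelSpace X] [IsFiniteMeasure μ]
    [SFinite ν] (hε : 0 < ε) (hν : IsReference ε μ ν) (u : Lp ℝ ∞ ν) :
    TV ε μ ν u = (ENNReal.ofReal ε)⁻¹ * (gapIntegral ν (labelMeasure μ 0) ε u +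
      gapIntegral ν (labelMeasure μ 1) ε (fun x => -u x)) := by
  have hu := isEssBddBy_coeFn u
  have hac := hν.labelMeasure_absolutelyContinuous
  have hball := hν.ae_ball_ne_zero hε
  have hneg {v : X → ℝ} (hv : v =ᵐ[ν] u) : (fun x => -v x) =ᵐ[ν] fun x => -u x := hv.neg
  refine le_antisymm ?_ (le_iInf₂ fun v hv => ?_)
  · have hopt := optRep_ae_eq ν u
    refine (iInf₂_le (optRep ν u) ⟨measurable_optRep ν hu.measurable,
      (memLp_congr_ae hopt).2 (Lp.memLp u), hopt⟩).trans ?_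
    rw [preTV_eq]
    gcongr
    · refine lintegral_supGap_le_gapIntegral (hac 0) (hball 0) hu hopt ?_
      filter_upwards [hν.ae_ball_subset 0] with x hx using iSup_optRep_le hu hx
    · refine lintegral_supGap_le_gapIntegral (hac 1) (hball 1) hu.neg (hneg hopt) ?_
      filter_upwards [hν.ae_ball_subset 1] with x hx using iSup_neg_optRep_le hu hx
  · rw [preTV_eq]
    gcongr
    · exact gapIntegral_le_lintegral_supGap (hac 0) (hball 0) hu hv.2.2
    · exact gapIntegral_le_lintegral_supGap (hac 1) (hball 1) hu.neg (hneg hv.2.2)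

/-! ### Properties of the total variation -/

variable [TopologicalSpace.SeparableSpace X] [BorelSpace X] [IsFiniteMeasure μ]

lemma IsReference.TV_lt_top [SFinite ν] (hε : 0 < ε) (hν : IsReference ε μ ν) (u : Lp ℝ ∞ ν) :
    TV ε μ ν u < ∞ := by
  rw [hν.TV_eq hε]
  refine ENNReal.mul_lt_top (ENNReal.inv_lt_top.2 (ENNReal.ofReal_pos.2 hε))
    (ENNReal.add_lt_top.2 ⟨?_, ?_⟩)
  · exact gapIntegral_lt_top (hν.labelMeasure_absolutelyContinuous 0) (hν.ae_ball_ne_zero hε 0)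
      (isEssBddBy_coeFn u)
  · exact gapIntegral_lt_top (hν.labelMeasure_absolutelyContinuous 1) (hν.ae_ball_ne_zero hε 1)
      (isEssBddBy_coeFn u).neg

lemma IsReference.TV_smul [SFinite ν] (hε : 0 < ε) (hν : IsReference ε μ ν) (c : ℝ≥0)
    (u : Lp ℝ ∞ ν) : TV ε μ ν (c • u) = c • TV ε μ ν u := by
  have hu := isEssBddBy_coeFn u
  have h0 : (c • u : Lp ℝ ∞ ν) =ᵐ[ν] fun x => c * u x := Lp.coeFn_smul (c : ℝ) u
  have h1 : (fun x => -(c • u : Lp ℝ ∞ ν) x) =ᵐ[ν] fun x => c * -u x := by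
    filter_upwards [h0] with x hx
    rw [hx, mul_neg]
  rw [hν.TV_eq hε, hν.TV_eq hε, gapIntegral_congr (hν.labelMeasure_absolutelyContinuous 0) ε h0,
    gapIntegral_congr (hν.labelMeasure_absolutelyContinuous 1) ε h1,
    gapIntegral_const_mul (hν.ae_ball_ne_zero hε 0) hu,
    gapIntegral_const_mul (hν.ae_ball_ne_zero hε 1) hu.neg, ENNReal.smul_def, smul_eq_mul]
  ring

lemma IsReference.convexOn_TV [SFinite ν] (hε : 0 < ε) (hν : IsReference ε μ ν) :
    ConvexOn ℝ≥0 univ (TV ε μ ν) := by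
  refine ⟨convex_univ, fun u _ w _ a b _ _ _ => ?_⟩
  have hu := isEssBddBy_coeFn u
  have hw := isEssBddBy_coeFn w
  have h0 : (a • u + b • w : Lp ℝ ∞ ν) =ᵐ[ν] fun x => a * u x + b * w x := by
    have hau : (a • u : Lp ℝ ∞ ν) =ᵐ[ν] fun x => a * u x := Lp.coeFn_smul (a : ℝ) u
    have hbw : (b • w : Lp ℝ ∞ ν) =ᵐ[ν] fun x => b * w x := Lp.coeFn_smul (b : ℝ) w
    filter_upwards [Lp.coeFn_add (a • u) (b • w), hau, hbw] with x h h1 h2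
    rw [h, Pi.add_apply, h1, h2]
  have h1 : (fun x => -(a • u + b • w : Lp ℝ ∞ ν) x) =ᵐ[ν] fun x => a * -u x + b * -w x := by
    filter_upwards [h0] with x hx
    rw [hx]
    ring
  rw [hν.TV_eq hε, hν.TV_eq hε, hν.TV_eq hε,
    gapIntegral_congr (hν.labelMeasure_absolutelyContinuous 0) ε h0,
    gapIntegral_congr (hν.labelMeasure_absolutelyContinuous 1) ε h1]
  refine (mul_le_mul_right (add_le_add
    (gapIntegral_convex (hν.ae_ball_ne_zero hε 0) hu hw a b)
    (gapIntegral_convex (hν.ae_ball_ne_zero hε 1) hu.neg hw.neg a b)) _).trans_eq ?_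
  simp only [ENNReal.smul_def, smul_eq_mul]
  ring

/-- Superadditivity of the limit inferior in `[0, ∞]`. -/
lemma liminf_add_liminf_le (a b : ℕ → ℝ≥0∞) :
    liminf a atTop + liminf b atTop ≤ liminf (fun k => a k + b k) atTop := by
  have hmono (c : ℕ → ℝ≥0∞) : Monotone fun n => ⨅ i ≥ n, c i := fun n k hnk =>
    le_iInf₂ fun i hi => iInf₂_le i (hnk.trans hi)
  simp only [liminf_eq_iSup_iInf_of_nat]
  rw [ENNReal.iSup_add_iSup_of_monotone (hmono a) (hmono b)]
  exact iSup_mono fun n => le_iInf₂ fun i hi => add_le_add (iInf₂_le i hi) (iInf₂_le i hi)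

lemma IsReference.TV_le_liminf [IsFiniteMeasure ν] (hε : 0 < ε) (hν : IsReference ε μ ν)
    {u : ℕ → Lp ℝ ∞ ν} {u₀ : Lp ℝ ∞ ν} (h : WeakStarTendsto ν u u₀) :
    TV ε μ ν u₀ ≤ liminf (fun k => TV ε μ ν (u k)) atTop := by
  obtain ⟨M, hM, hM₀⟩ := h.exists_isEssBddBy
  have hac := hν.labelMeasure_absolutelyContinuous
  simp_rw [hν.TV_eq hε]
  rw [ENNReal.liminf_const_mul_of_ne_top (ENNReal.inv_ne_top.2 (ENNReal.ofReal_pos.2 hε).ne')]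
  gcongr
  refine le_trans (add_le_add ?_ ?_) (liminf_add_liminf_le
    (fun k => gapIntegral ν (labelMeasure μ 0) ε (u k))
    (fun k => gapIntegral ν (labelMeasure μ 1) ε (fun x => -u k x)))
  · exact gapIntegral_le_liminf (hac 0) hε (hν.ae_ball_ne_zero hε 0) hM hM₀
      (fun A hA => h.tendsto_setIntegral hA) (h.tendsto_integral (hac 0))
  · refine gapIntegral_le_liminf (hac 1) hε (hν.ae_ball_ne_zero hε 1) (fun k => (hM k).neg)
      hM₀.neg (fun A hA => ?_) ?_
    · simpa only [integral_neg] using (h.tendsto_setIntegral hA).neg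
    · simpa only [integral_neg] using (h.tendsto_integral (hac 1)).neg

end

end

end AdvTV

theorem mainTheorem5 {X : Type*} [MetricSpace X] [TopologicalSpace.SeparableSpace X]
    [MeasurableSpace X] [BorelSpace X]
    (μ : Measure (X × Fin 2)) [IsProbabilityMeasure μ]
    (ν : Measure X) [IsFiniteMeasure ν]
    (ε : ℝ) (hε : 0 < ε) (hν : AdvTV.IsReference ε μ ν) :
    -- real-valued
    (∀ u : Lp ℝ ∞ ν, AdvTV.TV ε μ ν u < ∞) ∧
    -- positively homogeneous
    (∀ (c : ℝ≥0) (u : Lp ℝ ∞ ν), AdvTV.TV ε μ ν (c • u) = c • AdvTV.TV ε μ ν u) ∧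
    -- convex
    ConvexOn ℝ≥0 univ (AdvTV.TV ε μ ν) ∧
    -- weak-* lower semicontinuous
    (∀ (u : ℕ → Lp ℝ ∞ ν) (u₀ : Lp ℝ ∞ ν), AdvTV.WeakStarTendsto ν u u₀ →
      AdvTV.TV ε μ ν u₀ ≤ liminf (fun k => AdvTV.TV ε μ ν (u k)) atTop) := by
  exact ⟨hν.TV_lt_top hε, hν.TV_smul hε, hν.convexOn_TV hε, fun _ _ h => hν.TV_le_liminf hε h⟩
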